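/- For $\tau$ in the upper half plane $\mathbb{H}$ put $q=e^{2\pi i\tau}$, let $\sigma_1(r)=\sum_{d\mid r}d$, and let $$\widehat{E}_2(\tau)=1-\frac{3}{\pi\operatorname{Im}(\tau)}-24\sum_{r\ge 1}\sigma_1(r)q^r .$$ For a function $f(\tau)=\sum_{r\ge 0}c_f(r,\operatorname{Im}\tau)\,q^r$ on $\mathbb{H}$, an integer $M\ge 1$ and a residue class $m$ modulo $M$, let $$f|S_{M,m}(\tau)=\sum_{r\ge 0,\ r\equiv m\ (\mathrm{mod}\ M)}c_f(r,\operatorname{Im}\tau)\,q^r .$$ Let $M_2(\Gamma)$ denote the space of (holomorphic) modular forms of weight $2$ on a congruence subgroup $\Gamma\subseteq \mathrm{SL}_2(\mathbb{Z})$. **Theorem.** Let $n\ge 0$ be an integer, let $c_m\in\mathbb{C}$ for $m\in(\mathbb{Z}/2^n\mathbb{Z})^\times$, and suppose that $$f=\sum_{m\in(\mathbb{Z}/2^n\mathbb{Z})^\times}c_m\,\widehat{E}_2|S_{2^n,m}$$ lies in $M_2(\Gamma_1(2^{2n}))$. Then $f\in M_2(\Gamma_0(2^{2n}))$ if and only if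 $$f\in\operatorname{Span}_{\mathbb{C}}\left\{\widehat{E}_2|S_{2^j,m}\ :\ 1\le j\le\min(3,n),\ m\in(\mathbb{Z}/2^j\mathbb{Z})^\times\right\}.$$ -/

import Mathlib

open scoped MatrixGroups

noncomputable section

namespace EisensteinSieve

/-- The space `M_k(Γ)` of modular forms of weight `k` for a subgroup `Γ` of `SL(2, ℤ)`, as a set of
functions on the upper half plane. -/
def modularForms (k : ℤ) (Γ : Subgroup SL(2, ℤ)) : Set (UpperHalfPlane → ℂ) :=
  Set.range fun g : ModularForm (Γ : Subgroup (GL (Fin 2) ℝ)) k ↦ (g : UpperHalfPlane → ℂ)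

/-- The non-holomorphic weight 2 Eisenstein series
`1 - 3 / (π Im τ) - 24 ∑_{n ≥ 1} σ₁(n) qⁿ`, where `q = exp (2 π i τ)`. -/
def E2hat (τ : UpperHalfPlane) : ℂ :=
  1 - 3 / (Real.pi * τ.im) -
    24 * ∑' n : ℕ+, (ArithmeticFunction.sigma 1 (n : ℕ) : ℂ) *
      Complex.exp (2 * Real.pi * Complex.I * (n : ℕ) * (τ : ℂ))

/-- The `n`-th Fourier coefficient, at height `y > 0`, of a `1`-periodic function `f` on the upper
half plane: the `c(n, y)` in `f (x + i y) = ∑ n, c(n, y) qⁿ` with `q = exp (2 π i (x + i y))`.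
For holomorphic `f` it does not depend on `y`; for `E2hat` the coefficient `c(0, y)` does. -/
def fourierCoeffAt (f : UpperHalfPlane → ℂ) (n : ℕ) (y : ℝ) : ℂ :=
  ∫ x in (0 : ℝ)..1, f (UpperHalfPlane.ofComplex (x + y * Complex.I)) *
    Complex.exp (-(2 * Real.pi * Complex.I * n * (x + y * Complex.I)))

/-- The sieving operator `f ↦ f | S_{M,m}`, which keeps the terms `c(n, y) qⁿ` of the Fourier
expansion of `f` with `n ≡ m (mod M)`. -/
def sieve (M : ℕ) (m : ZMod M) (f : UpperHalfPlane → ℂ) (τ : UpperHalfPlane) : ℂ :=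
  ∑' n : ℕ, if (n : ZMod M) = m then
    fourierCoeffAt f n τ.im * Complex.exp (2 * Real.pi * Complex.I * n * (τ : ℂ)) else 0

/-- The integral does compute the coefficients of any Fourier expansion of `f`. -/
theorem fourierCoeffAt_eq (f : UpperHalfPlane → ℂ) (c : ℕ → ℝ → ℂ)
    (h : ∀ τ : UpperHalfPlane, HasSum
      (fun n : ℕ ↦ c n τ.im * Complex.exp (2 * Real.pi * Complex.I * n * (τ : ℂ))) (f τ))
    (n : ℕ) (y : ℝ) (hy : 0 < y) : fourierCoeffAt f n y = c n y := by
  have hmem : ∀ x : ℝ, 0 < ((x : ℂ) + y * Complex.I).im := fun x ↦ by simpa using hy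
  have hs : ∀ x : ℝ, HasSum (fun k : ℕ ↦ c k y * Complex.exp
      (2 * Real.pi * Complex.I * k * (x + y * Complex.I)))
      (f (UpperHalfPlane.ofComplex (x + y * Complex.I))) := by
    intro x
    have := h ⟨(x : ℂ) + y * Complex.I, hmem x⟩
    rw [UpperHalfPlane.ofComplex_apply_of_im_pos (hmem x)]
    convert this using 4
    simp [UpperHalfPlane.im]
  let F : ℕ → C(ℝ, ℂ) := fun k ↦
    ⟨fun x ↦ c k y * Complex.exp (2 * Real.pi * Complex.I * k * (x + y * Complex.I)) *
      Complex.exp (-(2 * Real.pi * Complex.I * n * (x + y * Complex.I))), by fun_prop⟩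
  have hF : ∀ k (x : ℝ), F k x = c k y * Complex.exp
      (2 * Real.pi * Complex.I * k * (x + y * Complex.I)) *
      Complex.exp (-(2 * Real.pi * Complex.I * n * (x + y * Complex.I))) := fun _ _ ↦ rfl
  have hnorm : ∀ k (x : ℝ), ‖F k x‖ = ‖F k 0‖ := by
    intro k x
    simp [hF, Complex.norm_exp]
  have hsum0 : Summable fun k ↦ ‖F k 0‖ := by
    have := ((hs 0).summable.mul_right
      (Complex.exp (-(2 * Real.pi * Complex.I * n * ((0 : ℝ) + y * Complex.I))))).norm
    exact this
  have hsum : Summable fun k ↦ ‖(F k).restrict (⟨Set.uIcc 0 1, isCompact_uIcc⟩ :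
      TopologicalSpace.Compacts ℝ)‖ := by
    refine Summable.of_nonneg_of_le (fun _ ↦ norm_nonneg _) (fun k ↦ ?_) hsum0
    rw [ContinuousMap.norm_le _ (norm_nonneg _)]
    intro x
    exact (hnorm k x).le
  have key := intervalIntegral.hasSum_intervalIntegral_of_summable_norm (a := 0) (b := 1) (f := F) hsum
  have hterm : ∀ k, ∫ x in (0 : ℝ)..1, F k x = if k = n then c n y else 0 := by
    intro k
    have e : ∀ x : ℝ, F k x = c k y * (Complex.exp (-(2 * Real.pi * (k - n) * y)) * Complex.exp
        (2 * Real.pi * Complex.I * (k - n) * x)) := by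
      intro x
      rw [hF, mul_assoc, ← Complex.exp_add, ← Complex.exp_add]
      congr 2
      linear_combination (2 * Real.pi * (k - n) * y : ℂ) * Complex.I_sq
    simp_rw [e]
    split_ifs with hk
    · subst hk; simp
    · have hne : (2 * Real.pi * Complex.I * ((k : ℂ) - n)) ≠ 0 :=
        mul_ne_zero Complex.two_pi_I_ne_zero (sub_ne_zero.mpr (by exact_mod_cast hk))
      rw [intervalIntegral.integral_const_mul, intervalIntegral.integral_const_mul,
        integral_exp_mul_complex hne]
      have : Complex.exp (2 * Real.pi * Complex.I * ((k : ℂ) - n)) = 1 := by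
        have := Complex.exp_int_mul_two_pi_mul_I ((k : ℤ) - n)
        rw [← this]; push_cast; ring_nf
      simp [this]
  simp_rw [hterm] at key
  have h2 := (hasSum_ite_eq n (c n y)).unique key
  rw [h2, fourierCoeffAt]
  refine intervalIntegral.integral_congr fun x _ ↦ ?_
  exact ((hs x).mul_right _).tsum_eq.symm

end EisensteinSieve

end

/-! `E2hat` has weight 2 for `SL(2, ℤ)`, and its sieve modulo `M` is a character-weighted average of
its translates by `k / M`. Conjugating `γ ∈ Γ₀(M²)` by suitable translations gives an integral
matrix again, so `γ` with upper left entry `a` carries the sieve at `m` to the sieve at `m * a ^ 2`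
(`sieve_E2hat_smul`).

All coefficients `σ₁(r)` with `r ≥ 1` are nonzero, so sieves at distinct units are linearly
independent (`sum_smul_sieve_E2hat_injective`). Hence `f` is `Γ₀`-invariant exactly when `c` is
constant on cosets of the squares. Modulo `2 ^ n` the unit squares are the kernel of reduction
modulo `2 ^ min 3 n` (`exists_mul_sq_of_unitsMap_eq`, `sq_eq_one_of_unit`), so `c` then descends to
that modulus.

For `n = 0` the span is zero, and holomorphy of `f` forces `c = 0`. -/

namespace EisensteinSieve
open UpperHalfPlane hiding I
open Complex

/-- The Fourier coefficients of `E2hat`. -/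
noncomputable def E2hatCoeff (n : ℕ) (y : ℝ) : ℂ :=
  if n = 0 then 1 - 3 / (Real.pi * y) else -24 * ArithmeticFunction.sigma 1 n

lemma E2hatCoeff_ne_zero {n : ℕ} (hn : n ≠ 0) (y : ℝ) : E2hatCoeff n y ≠ 0 := by
  have : ArithmeticFunction.sigma 1 n ≠ 0 := (ArithmeticFunction.sigma_pos 1 n hn).ne'
  simp [E2hatCoeff, hn, this]

lemma E2hat_eq_E2_sub (τ : ℍ) : E2hat τ = EisensteinSeries.E2 τ - 3 / (Real.pi * τ.im) := by
  have h : ∀ n : ℕ, Complex.exp (2 * Real.pi * Complex.I * n * (τ : ℂ)) =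
      Complex.exp (2 * Real.pi * Complex.I * (τ : ℂ)) ^ n := fun n ↦ by
    rw [← Complex.exp_nat_mul]; ring_nf
  simp only [E2hat, h, EisensteinSeries.E2_eq_tsum_cexp]
  ring

lemma hasSum_E2hat (τ : ℍ) : HasSum (fun n : ℕ ↦ E2hatCoeff n τ.im *
    Complex.exp (2 * Real.pi * Complex.I * n * (τ : ℂ))) (E2hat τ) := by
  have h := (EisensteinSeries.hasSum_qExpansion_E2 (z := τ)).add
    (hasSum_ite_eq 0 (-(3 / (Real.pi * τ.im) : ℂ)))
  rw [E2hat_eq_E2_sub, sub_eq_add_neg]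
  refine h.congr_fun fun n ↦ ?_
  have h' : Complex.exp (2 * Real.pi * Complex.I * n * (τ : ℂ)) =
      Complex.exp (2 * Real.pi * Complex.I * (τ : ℂ)) ^ n := by
    rw [← Complex.exp_nat_mul]; ring_nf
  rw [h']
  rcases eq_or_ne n 0 with rfl | hn
  · simp [E2hatCoeff, sub_eq_add_neg]
  · simp [E2hatCoeff, hn]

lemma fourierCoeffAt_E2hat (n : ℕ) {y : ℝ} (hy : 0 < y) :
    fourierCoeffAt E2hat n y = E2hatCoeff n y :=
  fourierCoeffAt_eq _ _ hasSum_E2hat n y hy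

/-- The quasimodular error of `E2` is cancelled by that of `3 / (π Im τ)`, since the conjugate of
`cτ + d` is `cτ + d - 2ic Im τ`. -/
lemma E2hat_smul (γ : SL(2, ℤ)) (τ : ℍ) :
    E2hat (γ • τ) = ((γ 1 0 : ℂ) * τ + γ 1 1) ^ 2 * E2hat τ := by
  have h := congr_fun (EisensteinSeries.E2_slash_action γ) τ
  have hd : denom (γ : GL (Fin 2) ℝ) τ = (γ 1 0 : ℂ) * τ + γ 1 1 := by simp [denom]
  have hne : (γ 1 0 : ℂ) * τ + γ 1 1 ≠ 0 := hd ▸ denom_ne_zero _ _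
  rw [ModularForm.SL_slash_apply, hd] at h
  have him : ((γ • τ).im : ℂ) = τ.im / (((γ 1 0 : ℂ) * τ + γ 1 1) *
      (((γ 1 0 : ℂ) * τ + γ 1 1) - 2 * Complex.I * γ 1 0 * τ.im)) := by
    rw [ModularGroup.im_smul_eq_div_normSq, hd, Complex.ofReal_div, ← Complex.mul_conj]
    congr 2
    simp only [map_add, map_mul, map_intCast]
    have h2 : (starRingEnd ℂ) (τ : ℂ) = τ - 2 * Complex.I * τ.im := by
      apply Complex.ext <;> simp; ring
    rw [h2]; ring
  have hy : (τ.im : ℂ) ≠ 0 := by exact_mod_cast τ.im_ne_zero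
  have hpi : (Real.pi : ℂ) ≠ 0 := by exact_mod_cast Real.pi_ne_zero
  have hE : EisensteinSeries.E2 (γ • τ) = ((γ 1 0 : ℂ) * τ + γ 1 1) ^ 2 *
      (EisensteinSeries.E2 τ - 6 * Complex.I * γ 1 0 / (Real.pi * ((γ 1 0 : ℂ) * τ + γ 1 1))) := by
    have h3 : (EisensteinSeries.E2 - (1 / (2 * riemannZeta 2)) • EisensteinSeries.D2 γ) τ =
        EisensteinSeries.E2 τ - 6 * Complex.I * γ 1 0 / (Real.pi * ((γ 1 0 : ℂ) * τ + γ 1 1)) := by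
      simp only [Pi.sub_apply, Pi.smul_apply, smul_eq_mul, EisensteinSeries.D2, hd,
        riemannZeta_two]
      field_simp
    rw [← h3, ← h]
    simp only [zpow_neg]
    norm_cast
    field_simp
  rw [E2hat_eq_E2_sub, E2hat_eq_E2_sub, hE, him]
  field_simp
  ring

lemma summable_E2hat_terms (τ : ℍ) (p : ℕ → Prop) [DecidablePred p] :
    Summable fun n : ℕ ↦ if p n then E2hatCoeff n τ.im *
      Complex.exp (2 * Real.pi * Complex.I * n * (τ : ℂ)) else 0 := by
  refine ((hasSum_E2hat τ).summable.indicator {n | p n}).congr fun n ↦ ?_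
  simp only [Set.indicator_apply, Set.mem_ofPred_eq]

lemma hasSum_sieve_E2hat {M : ℕ} (m : ZMod M) (τ : ℍ) :
    HasSum (fun n : ℕ ↦ if (n : ZMod M) = m then E2hatCoeff n τ.im *
      Complex.exp (2 * Real.pi * Complex.I * n * (τ : ℂ)) else 0) (sieve M m E2hat τ) := by
  have := (summable_E2hat_terms τ fun n ↦ (n : ZMod M) = m).hasSum
  simpa only [sieve, fourierCoeffAt_E2hat _ τ.im_pos] using! this

lemma isUnit_apply_zero_zero_of_mem_Gamma0 {M : ℕ} {γ : SL(2, ℤ)}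
    (hγ : γ ∈ CongruenceSubgroup.Gamma0 (M ^ 2)) : IsUnit (γ 0 0 : ZMod M) := by
  refine IsUnit.of_mul_eq_one (γ 1 1 : ZMod M) ?_
  have hc : ((γ 1 0 : ℤ) : ZMod M) = 0 := by
    rw [CongruenceSubgroup.Gamma0_mem, ZMod.intCast_zmod_eq_zero_iff_dvd] at hγ
    rw [ZMod.intCast_zmod_eq_zero_iff_dvd]
    exact (by push_cast; exact dvd_pow_self _ two_ne_zero : (M : ℤ) ∣ (M ^ 2 : ℕ)).trans hγ
  have hdet := γ.det_coe
  rw [Matrix.det_fin_two] at hdet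
  have := congr_arg (Int.cast : ℤ → ZMod M) hdet
  push_cast at this
  rwa [hc, mul_zero, sub_zero] at this

/-! ### Sieves as averages of translates -/

variable {M : ℕ} [NeZero M]

lemma hasSum_E2hat_vadd (k : ℤ) (τ : ℍ) :
    HasSum (fun n : ℕ ↦ ZMod.stdAddChar ((n : ZMod M) * (k : ZMod M)) * (E2hatCoeff n τ.im *
      Complex.exp (2 * Real.pi * Complex.I * n * (τ : ℂ))))
      (E2hat (((k : ℝ) / M) +ᵥ τ)) := by
  refine (hasSum_E2hat (((k : ℝ) / M) +ᵥ τ)).congr_fun fun n ↦ ?_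
  have : (n : ZMod M) * (k : ZMod M) = ((n * k : ℤ) : ZMod M) := by push_cast; rfl
  rw [this, ZMod.stdAddChar_coe, vadd_im, coe_vadd, mul_left_comm, ← Complex.exp_add]
  congr 2
  push_cast
  ring

/-- Translates of `E2hat` by `k / M`, for `k` a residue class modulo `M`. -/
noncomputable def E2hatTranslate (k : ZMod M) (τ : ℍ) : ℂ := E2hat (((k.val : ℝ) / M) +ᵥ τ)

lemma hasSum_E2hatTranslate (k : ZMod M) (τ : ℍ) :
    HasSum (fun n : ℕ ↦ ZMod.stdAddChar ((n : ZMod M) * k) * (E2hatCoeff n τ.im *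
      Complex.exp (2 * Real.pi * Complex.I * n * (τ : ℂ)))) (E2hatTranslate k τ) := by
  simpa [E2hatTranslate] using hasSum_E2hat_vadd (M := M) (k.val : ℤ) τ

lemma E2hatTranslate_intCast (k : ℤ) (τ : ℍ) :
    E2hatTranslate (k : ZMod M) τ = E2hat (((k : ℝ) / M) +ᵥ τ) :=
  (hasSum_E2hatTranslate (k : ZMod M) τ).unique (hasSum_E2hat_vadd k τ)

/-- Orthogonality of the additive characters modulo `M`, applied termwise to the Fourier expansions.
-/
lemma sieve_E2hat_eq_sum (m : ZMod M) (τ : ℍ) :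
    sieve M m E2hat τ =
      (M : ℂ)⁻¹ * ∑ k : ZMod M, ZMod.stdAddChar (-(m * k)) * E2hatTranslate k τ := by
  have h := (hasSum_sum (s := Finset.univ) fun (k : ZMod M) _ ↦
    (hasSum_E2hatTranslate k τ).mul_left (ZMod.stdAddChar (-(m * k)))).mul_left ((M : ℂ)⁻¹)
  refine (hasSum_sieve_E2hat m τ).unique (h.congr_fun fun n ↦ ?_)
  have hM : (M : ℂ) ≠ 0 := by exact_mod_cast NeZero.ne M
  have hs := AddChar.sum_mulShift ((n : ZMod M) - m) (ZMod.isPrimitive_stdAddChar M)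
  have : ∀ k : ZMod M, (ZMod.stdAddChar (-(m * k)) : ℂ) * ZMod.stdAddChar ((n : ZMod M) * k) =
      ZMod.stdAddChar (k * ((n : ZMod M) - m)) := fun k ↦ by
    rw [← AddChar.map_add_eq_mul]; congr 1; ring
  simp_rw [← mul_assoc, this, ← Finset.sum_mul, mul_assoc] 
  rw [hs]
  simp only [sub_eq_zero, ZMod.card]
  split_ifs <;> simp [hM]

/-- The factor `a ^ 2` makes the upper right entry of the conjugate integral: it contributes `l * a
* (a * d - 1) / M`, and `a * d ≡ 1` modulo `M ^ 2`. The remaining term has denominator `M ^ 2`,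
which divides `c`. -/
lemma E2hatTranslate_smul {γ : SL(2, ℤ)} (hγ : γ ∈ CongruenceSubgroup.Gamma0 (M ^ 2))
    (k : ZMod M) (τ : ℍ) :
    E2hatTranslate (k * (γ 0 0 : ZMod M) ^ 2) (γ • τ) =
      ((γ 1 0 : ℂ) * τ + γ 1 1) ^ 2 * E2hatTranslate k τ := by
  rw [CongruenceSubgroup.Gamma0_mem, ZMod.intCast_zmod_eq_zero_iff_dvd] at hγ
  obtain ⟨e, he⟩ := hγ
  obtain ⟨l, rfl⟩ := ZMod.intCast_surjective k
  have hdet : γ 0 0 * γ 1 1 - γ 0 1 * γ 1 0 = 1 := by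
    have := γ.det_coe
    rwa [Matrix.det_fin_two] at this
  set a := γ 0 0
  set b := γ 0 1
  set c := γ 1 0
  set d := γ 1 1
  push_cast at he
  have hM : (M : ℂ) ≠ 0 := by exact_mod_cast NeZero.ne M
  have h1 : ((l : ℤ) : ZMod M) * (a : ZMod M) ^ 2 = ((l * a ^ 2 : ℤ) : ZMod M) := by push_cast; rfl
  rw [h1, E2hatTranslate_intCast, E2hatTranslate_intCast]
  -- the conjugate of `γ` by the two translations
  let g : SL(2, ℤ) := ⟨!![a + l * a ^ 2 * M * e, b + l * a * b * M * e - l ^ 2 * a ^ 2 * e;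
      c, d - l * M * e], by
    rw [Matrix.det_fin_two_of]
    rw [he] at hdet ⊢
    linear_combination (1 + l * a * M * e) * hdet⟩
  have hdenom : (c : ℂ) * τ + d ≠ 0 := by
    have h := denom_ne_zero (γ : GL (Fin 2) ℝ) τ
    simpa [denom] using h
  have hc : (c : ℂ) = M ^ 2 * e := by exact_mod_cast congr_arg (Int.cast : ℤ → ℂ) he
  have hdet' : (a : ℂ) * d - b * c = 1 := by exact_mod_cast congr_arg (Int.cast : ℤ → ℂ) hdet
  have hg : (g 1 0 : ℂ) * (((l : ℝ) / M) +ᵥ τ : ℍ) + g 1 1 = (c : ℂ) * τ + d := by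
    simp only [g, coe_vadd, Matrix.of_apply, Matrix.cons_val', Matrix.cons_val_zero,
      Matrix.cons_val_one, Matrix.cons_val_fin_one]
    push_cast
    rw [hc]
    field_simp
    ring
  have hsmul : ((((l * a ^ 2 : ℤ) : ℝ) / M) +ᵥ (γ • τ) : ℍ) = g • (((l : ℝ) / M) +ᵥ τ : ℍ) := by
    apply UpperHalfPlane.ext
    rw [coe_vadd, coe_specialLinearGroup_apply, coe_specialLinearGroup_apply]
    simp only [eq_intCast, Complex.ofReal_intCast]
    rw [hg]
    simp only [g, coe_vadd, Matrix.of_apply, Matrix.cons_val', Matrix.cons_val_zero,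
      Matrix.cons_val_one, Matrix.cons_val_fin_one]
    push_cast
    change _ + ((a : ℂ) * τ + b) / ((c : ℂ) * τ + d) = _
    rw [div_add_div _ _ hM hdenom, div_eq_div_iff (mul_ne_zero hM hdenom) hdenom]
    rw [hc] at hdet' ⊢
    field_simp
    linear_combination (((M : ℂ) ^ 2 * e * τ + d) * (l * a)) * hdet'
  rw [hsmul, E2hat_smul, hg]

lemma sieve_E2hat_smul {γ : SL(2, ℤ)} (hγ : γ ∈ CongruenceSubgroup.Gamma0 (M ^ 2))
    (m : ZMod M) (τ : ℍ) :
    sieve M m E2hat (γ • τ) =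
      ((γ 1 0 : ℂ) * τ + γ 1 1) ^ 2 * sieve M (m * (γ 0 0 : ZMod M) ^ 2) E2hat τ := by
  obtain ⟨u, hu⟩ := isUnit_apply_zero_zero_of_mem_Gamma0 hγ
  rw [sieve_E2hat_eq_sum, sieve_E2hat_eq_sum, mul_left_comm]
  congr 1
  rw [Finset.mul_sum, ← Equiv.sum_comp (Units.mulRight (u ^ 2))]
  refine Finset.sum_congr rfl fun k _ ↦ ?_
  have := E2hatTranslate_smul hγ k τ
  rw [← hu] at this ⊢
  rw [Units.mulRight_apply, Units.val_pow_eq_pow_val, this, mul_left_comm]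
  congr 4
  ring

/-! ### Passing from `Γ₁` to `Γ₀`, and Fourier coefficients -/

lemma mem_modularForms_two_iff {N : ℕ} {f : ℍ → ℂ} [NeZero N]
    (hf : f ∈ modularForms 2 (CongruenceSubgroup.Gamma1 N)) :
    f ∈ modularForms 2 (CongruenceSubgroup.Gamma0 N) ↔
      ∀ γ ∈ CongruenceSubgroup.Gamma0 N, ∀ τ : ℍ,
        f (γ • τ) = ((γ 1 0 : ℂ) * τ + γ 1 1) ^ 2 * f τ := by
  constructor
  · rintro ⟨g, rfl⟩ γ hγ τ
    have := SlashInvariantForm.slash_action_eqn_SL'' g hγ τ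
    simpa [denom] using mod_cast this
  · intro h
    obtain ⟨g, rfl⟩ := hf
    refine ⟨{ toFun := g, slash_action_eq' := ?_, holo' := g.holo', bdd_at_cusps' := ?_ }, rfl⟩
    · rintro _ ⟨γ, hγ, rfl⟩
      ext τ
      change (SlashAction.map (2 : ℤ) γ (g : ℍ → ℂ)) τ = g τ
      have h' : g (γ • τ) = _ := h γ hγ τ
      rw [ModularForm.SL_slash_apply, h']
      have hd : denom (γ : GL (Fin 2) ℝ) τ = (γ 1 0 : ℂ) * τ + γ 1 1 := by simp [denom]
      have hne : (γ 1 0 : ℂ) * τ + γ 1 1 ≠ 0 := hd ▸ denom_ne_zero _ _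
      rw [hd, zpow_neg]
      norm_cast
      field_simp
    -- Both groups are arithmetic, so they have the same cusps as `SL(2, ℤ)`.
    · intro c hc
      rw [Subgroup.IsArithmetic.isCusp_iff_isCusp_SL2Z] at hc
      exact g.bdd_at_cusps' ((Subgroup.IsArithmetic.isCusp_iff_isCusp_SL2Z _).mpr hc)

lemma fourierCoeffAt_zero_eq_of_mem_modularForms {N : ℕ} [NeZero N] {f : ℍ → ℂ} {k : ℤ}
    (hf : f ∈ modularForms k (CongruenceSubgroup.Gamma1 N)) {y₁ y₂ : ℝ} (h₁ : 0 < y₁)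
    (h₂ : 0 < y₂) (n : ℕ) : fourierCoeffAt f n y₁ = fourierCoeffAt f n y₂ := by
  obtain ⟨g, rfl⟩ := hf
  have hper : (1 : ℝ) ∈ ((CongruenceSubgroup.Gamma1 N : Subgroup SL(2, ℤ)) :
      Subgroup (GL (Fin 2) ℝ)).strictPeriods := by
    simp
  have h := fourierCoeffAt_eq g (fun n _ ↦ (qExpansion 1 g).coeff n) (fun τ ↦ by
    refine (ModularForm.hasSum_qExpansion g one_pos hper τ).congr_fun fun n ↦ ?_
    rw [Function.Periodic.qParam, ← Complex.exp_nat_mul]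
    congr 2
    push_cast
    ring) n
  rw [h _ h₁, h _ h₂]

/-- The Fourier expansion of a linear combination of sieved `E2hat`s. -/
lemma hasSum_sum_smul_sieve_E2hat (c : (ZMod M)ˣ → ℂ) (τ : ℍ) :
    HasSum (fun n : ℕ ↦ ((∑ m : (ZMod M)ˣ, if (n : ZMod M) = m then c m else 0) *
      E2hatCoeff n τ.im) * Complex.exp (2 * Real.pi * Complex.I * n * (τ : ℂ)))
      ((∑ m : (ZMod M)ˣ, c m • sieve M (m : ZMod M) E2hat) τ) := by
  have h := hasSum_sum (s := Finset.univ) fun (m : (ZMod M)ˣ) _ ↦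
    (hasSum_sieve_E2hat (m : ZMod M) τ).mul_left (c m)
  rw [Finset.sum_apply]
  refine h.congr_fun fun n ↦ ?_
  rw [mul_assoc, Finset.sum_mul]
  refine Finset.sum_congr rfl fun m _ ↦ ?_
  split_ifs <;> simp

lemma sum_ite_natCast_eq (c : (ZMod M)ˣ → ℂ) {n : ℕ} {u : (ZMod M)ˣ}
    (h : (n : ZMod M) = u) : (∑ m : (ZMod M)ˣ, if (n : ZMod M) = m then c m else 0) = c u := by
  simp [h, Units.ext_iff.symm]

lemma fourierCoeffAt_sum_smul_sieve_E2hat (c : (ZMod M)ˣ → ℂ) {n : ℕ}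
    {u : (ZMod M)ˣ} (h : (n : ZMod M) = u) {y : ℝ} (hy : 0 < y) :
    fourierCoeffAt (∑ m : (ZMod M)ˣ, c m • sieve M (m : ZMod M) E2hat) n y =
      c u * E2hatCoeff n y := by
  rw [fourierCoeffAt_eq _ (fun n y ↦ (∑ m : (ZMod M)ˣ, if (n : ZMod M) = m then c m else 0) * E2hatCoeff n y)
    (hasSum_sum_smul_sieve_E2hat c) n y hy,
    sum_ite_natCast_eq c h]

lemma sum_smul_sieve_E2hat_injective {c c' : (ZMod M)ˣ → ℂ}
    (h : ∑ m : (ZMod M)ˣ, c m • sieve M (m : ZMod M) E2hat =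
      ∑ m : (ZMod M)ˣ, c' m • sieve M (m : ZMod M) E2hat) : c = c' := by
  ext u
  -- Adding `M` keeps the index positive even when `M = 1`; the constant coefficient may vanish.
  have hu : (((u : ZMod M).val + M : ℕ) : ZMod M) = u := by simp
  have h1 := fourierCoeffAt_sum_smul_sieve_E2hat c hu one_pos
  rw [h, fourierCoeffAt_sum_smul_sieve_E2hat c' hu one_pos] at h1
  have : (u : ZMod M).val + M ≠ 0 := by have := NeZero.ne M; omega
  exact (mul_right_cancel₀ (E2hatCoeff_ne_zero this 1) h1).symm

/-! ### Squares of units modulo powers of two -/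

lemma exists_sq_modEq_two_pow {x : ℤ} (hx : x ≡ 1 [ZMOD 8]) (n : ℕ) :
    ∃ a : ℤ, a ^ 2 ≡ x [ZMOD 2 ^ (n + 3)] := by
  induction n with
  | zero => exact ⟨1, by simpa using hx.symm⟩
  | succ n ih =>
    obtain ⟨a, ha⟩ := ih
    obtain ⟨t, ht⟩ := ha.dvd
    have hodd : Odd a := by
      have h8 : (2 : ℤ) ∣ x - a ^ 2 := by
        rw [ht, pow_succ]; exact ⟨2 ^ (n + 2) * t, by ring⟩
      have h1 : (2 : ℤ) ∣ 1 - x := (by norm_num : (2 : ℤ) ∣ 8).trans hx.dvd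
      rcases Int.even_or_odd a with h | h
      · have := h.two_dvd
        have : (2 : ℤ) ∣ a ^ 2 := dvd_pow this two_ne_zero
        omega
      · exact h
    obtain ⟨b, rfl⟩ := hodd
    -- Hensel step: as `a` is odd, this correction changes `a ^ 2` by `t * 2 ^ (n + 3)` modulo `2 ^
    -- (n + 4)`.
    refine ⟨2 * b + 1 + t * 2 ^ (n + 2), (Int.modEq_iff_dvd.mpr ⟨-(t * b) - t ^ 2 * 2 ^ n, ?_⟩)⟩
    have hx' : x = (2 * b + 1) ^ 2 + 2 ^ (n + 3) * t := by linarith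
    rw [hx']
    ring

lemma exists_mul_sq_of_unitsMap_eq {n j : ℕ} (hj : j = min 3 n) (h : 2 ^ j ∣ 2 ^ n)
    {u v : (ZMod (2 ^ n))ˣ} (huv : ZMod.unitsMap h u = ZMod.unitsMap h v) :
    ∃ a : (ZMod (2 ^ n))ˣ, u = v * a ^ 2 := by
  rcases le_or_gt n 3 with hn | hn
  · rw [min_eq_right hn] at hj
    subst hj
    rw [ZMod.unitsMap_self] at huv
    exact ⟨1, by simpa using! huv⟩
  · rw [min_eq_left hn.le] at hj
    subst hj
    obtain ⟨k, rfl⟩ := Nat.exists_eq_add_of_le' hn.le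
    obtain ⟨x, hx⟩ := ZMod.intCast_surjective ((v⁻¹ * u : (ZMod (2 ^ (k + 3)))ˣ) : ZMod (2 ^ (k + 3)))
    have hx8 : x ≡ 1 [ZMOD 8] := by
      have h1 : ZMod.unitsMap h (v⁻¹ * u) = 1 := by rw [map_mul, map_inv, huv, inv_mul_cancel]
      have h2 := congr_arg Units.val h1
      rw [ZMod.unitsMap_def, Units.coe_map, ← hx] at h2
      have h3 : ((x : ℤ) : ZMod (2 ^ 3)) = ((1 : ℤ) : ZMod (2 ^ 3)) := by simpa using h2
      simpa using (ZMod.intCast_eq_intCast_iff _ _ _).mp h3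
    obtain ⟨a, ha⟩ := exists_sq_modEq_two_pow hx8 k
    have ha' : ((a : ZMod (2 ^ (k + 3)))) ^ 2 = ((v⁻¹ * u : (ZMod (2 ^ (k + 3)))ˣ) : ZMod (2 ^ (k + 3))) := by
      rw [← hx]
      have := (ZMod.intCast_eq_intCast_iff (a ^ 2) x (2 ^ (k + 3))).mpr (by exact_mod_cast ha)
      exact_mod_cast this
    have hau : IsUnit (a : ZMod (2 ^ (k + 3))) := by
      rw [← isUnit_pow_iff two_ne_zero, ha']
      exact Units.isUnit _
    obtain ⟨w, hw⟩ := hau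
    refine ⟨w, ?_⟩
    have : w ^ 2 = v⁻¹ * u := Units.ext (by rw [← ha', ← hw]; rfl)
    rw [this, mul_inv_cancel_left]

/-- Source of the bound 3: odd squares are 1 modulo 8, but `3 ^ 2 ≠ 1` modulo 16. -/
lemma sq_eq_one_of_unit {j : ℕ} (hj : j ≤ 3) (a : (ZMod (2 ^ j))ˣ) : (a : ZMod (2 ^ j)) ^ 2 = 1 := by
  have : ∀ a : (ZMod (2 ^ j))ˣ, a ^ 2 = 1 := by interval_cases j <;> decide
  simpa using congr_arg Units.val (this a)

lemma exists_mem_Gamma0_of_unit (a : (ZMod M)ˣ) (N : ℕ) 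
    (hN : ∀ k : ℕ, IsUnit (k : ZMod M) → Nat.Coprime k N) :
    ∃ γ ∈ CongruenceSubgroup.Gamma0 N, (γ 0 0 : ZMod M) = a := by
  have hc : IsCoprime ((a : ZMod M).val : ℤ) (N : ℤ) :=
    Nat.isCoprime_iff_coprime.mpr (hN _ (by simp))
  obtain ⟨d, b, h⟩ := hc
  refine ⟨⟨!![((a : ZMod M).val : ℤ), -b; (N : ℤ), d], ?_⟩, ?_, ?_⟩
  · rw [Matrix.det_fin_two_of]; linarith
  · exact CongruenceSubgroup.Gamma0_mem.mpr (by simp)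
  · simp

/-- A combination of sieves modulo `M` whose coefficients depend only on the class modulo a divisor
`K` of `M` with the same prime factors is a combination of sieves modulo `K`. -/
lemma sum_smul_sieve_comp_unitsMap {M K : ℕ} [NeZero M] [NeZero K] (h : K ∣ M)
    (hu : ∀ n : ℕ, IsUnit (n : ZMod K) → IsUnit (n : ZMod M)) (c : (ZMod K)ˣ → ℂ) :
    ∑ m : (ZMod M)ˣ, c (ZMod.unitsMap h m) • sieve M (m : ZMod M) E2hat =
      ∑ m : (ZMod K)ˣ, c m • sieve K (m : ZMod K) E2hat := by
  ext τ
  refine (hasSum_sum_smul_sieve_E2hat _ τ).unique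
    ((hasSum_sum_smul_sieve_E2hat c τ).congr_fun fun n ↦ ?_)
  congr 2
  by_cases hn : IsUnit (n : ZMod M)
  · obtain ⟨u, hun⟩ := hn
    rw [sum_ite_natCast_eq _ hun.symm, sum_ite_natCast_eq (u := ZMod.unitsMap h u)]
    rw [ZMod.unitsMap_def, Units.coe_map, hun]
    simp
  · rw [Finset.sum_eq_zero, Finset.sum_eq_zero]
    · intro m _
      rw [if_neg]
      exact fun hm ↦ hn (hu n (hm ▸ m.isUnit))
    · intro m _
      rw [if_neg]
      exact fun hm ↦ hn (hm ▸ m.isUnit)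

end EisensteinSieve

open EisensteinSieve UpperHalfPlane

theorem theorem2p12 (n : ℕ) (c : (ZMod (2 ^ n))ˣ → ℂ) (f : UpperHalfPlane → ℂ)
    (hf : f = ∑ m : (ZMod (2 ^ n))ˣ,
      c m • EisensteinSieve.sieve (2 ^ n) (m : ZMod (2 ^ n)) EisensteinSieve.E2hat)
    (hf1 : f ∈ EisensteinSieve.modularForms 2 (CongruenceSubgroup.Gamma1 (2 ^ (2 * n)))) :
    f ∈ EisensteinSieve.modularForms 2 (CongruenceSubgroup.Gamma0 (2 ^ (2 * n))) ↔
      f ∈ Submodule.span ℂ {g : UpperHalfPlane → ℂ | ∃ j : ℕ, 1 ≤ j ∧ j ≤ min 3 n ∧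
        ∃ m : (ZMod (2 ^ j))ˣ,
          g = EisensteinSieve.sieve (2 ^ j) (m : ZMod (2 ^ j)) EisensteinSieve.E2hat} := by
  rw [mem_modularForms_two_iff hf1]
  constructor
  · intro hinv
    rcases Nat.eq_zero_or_pos n with rfl | hn
    -- Here `f` is a multiple of `E2hat` itself, whose constant coefficient varies with the height;
    -- comparing heights 1 and 2 kills the multiple.
    · have : Subsingleton (ZMod (2 ^ 0)) := inferInstanceAs (Subsingleton (ZMod 1))
      have hcast : ((0 : ℕ) : ZMod (2 ^ 0)) = (1 : (ZMod (2 ^ 0))ˣ) := Subsingleton.elim _ _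
      have h := fourierCoeffAt_zero_eq_of_mem_modularForms hf1 one_pos two_pos 0
      rw [hf, fourierCoeffAt_sum_smul_sieve_E2hat c hcast one_pos,
        fourierCoeffAt_sum_smul_sieve_E2hat c hcast two_pos] at h
      have hpi : (Real.pi : ℂ) ≠ 0 := by exact_mod_cast Real.pi_ne_zero
      have hc : c = 0 := by
        ext u
        rw [Subsingleton.elim u 1]
        simp only [E2hatCoeff, if_true] at h
        push_cast at h
        field_simp at h
        simp only [Pi.zero_apply]
        linear_combination (-1 / 3 : ℂ) * h
      rw [hf, hc]
      simp
    -- Apply invariance to a `γ` with upper left entry `a`, then compare coefficients.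
    · have hcsq : ∀ u a : (ZMod (2 ^ n))ˣ, c (u * a ^ 2) = c u := by
        intro u a
        obtain ⟨γ, hγ, hγa⟩ := exists_mem_Gamma0_of_unit a ((2 ^ n) ^ 2) fun k hk ↦
          ((ZMod.isUnit_iff_coprime _ _).mp hk).pow_right 2
        have hsum : ∑ m : (ZMod (2 ^ n))ˣ, c (m * (a ^ 2)⁻¹) • sieve (2 ^ n) (m : ZMod (2 ^ n)) E2hat
            = ∑ m : (ZMod (2 ^ n))ˣ, c m • sieve (2 ^ n) (m : ZMod (2 ^ n)) E2hat := by
          rw [← Equiv.sum_comp (Equiv.mulRight (a ^ 2))]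
          ext τ
          have hne : (γ 1 0 : ℂ) * τ + γ 1 1 ≠ 0 := by
            simpa [denom] using denom_ne_zero (γ : GL (Fin 2) ℝ) τ
          have h := hinv γ (by rwa [mul_comm 2 n, pow_mul]) τ
          rw [← hf]
          refine mul_left_cancel₀ (pow_ne_zero 2 hne) (Eq.trans ?_ h)
          rw [hf, Finset.sum_apply, Finset.sum_apply, Finset.mul_sum]
          refine Finset.sum_congr rfl fun m _ ↦ ?_
          simp only [Pi.smul_apply, smul_eq_mul, sieve_E2hat_smul hγ, hγa, Equiv.coe_mulRight,
            mul_inv_cancel_right, Units.val_mul, Units.val_pow_eq_pow_val]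
          ring
        have h := congr_fun (sum_smul_sieve_E2hat_injective hsum) (u * a ^ 2)
        rw [← h]
        exact congr_arg c (mul_inv_cancel_right u (a ^ 2))
      have hjn : min 3 n ≤ n := min_le_right _ _
      have hdvd : 2 ^ min 3 n ∣ 2 ^ n := pow_dvd_pow 2 hjn
      let s := Function.surjInv (ZMod.unitsMap_surjective hdvd)
      have hs : c = fun m ↦ (c ∘ s) (ZMod.unitsMap hdvd m) := by
        ext u
        obtain ⟨a, ha⟩ := exists_mul_sq_of_unitsMap_eq rfl hdvd
          (Function.surjInv_eq (ZMod.unitsMap_surjective hdvd) (ZMod.unitsMap hdvd u))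
        simp only [Function.comp_apply, s]
        rw [ha, hcsq]
      have hunit : ∀ k : ℕ, IsUnit (k : ZMod (2 ^ min 3 n)) → IsUnit (k : ZMod (2 ^ n)) := by
        intro k hk
        rw [ZMod.isUnit_iff_coprime] at hk ⊢
        exact Nat.Coprime.pow_right _ ((Nat.coprime_pow_right_iff (by omega) _ _).mp hk)
      rw [hf, hs, sum_smul_sieve_comp_unitsMap hdvd hunit]
      refine Submodule.sum_mem _ fun m _ ↦ Submodule.smul_mem _ _ (Submodule.subset_span ?_)
      exact ⟨min 3 n, by omega, le_rfl, m, rfl⟩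
  · intro hspan γ hγ τ
    clear hf hf1
    induction hspan using Submodule.span_induction with
    | mem g hg =>
      obtain ⟨j, hj1, hj, m, rfl⟩ := hg
      -- Since `j ≤ n`, the transformation law at modulus `2 ^ j` applies to `γ`.
      have hγj : γ ∈ CongruenceSubgroup.Gamma0 ((2 ^ j) ^ 2) := by
        rw [CongruenceSubgroup.Gamma0_mem, ZMod.intCast_zmod_eq_zero_iff_dvd] at hγ ⊢
        refine dvd_trans ?_ hγ
        rw [← pow_mul]
        exact_mod_cast pow_dvd_pow 2 (by omega)
      obtain ⟨u, hu⟩ := isUnit_apply_zero_zero_of_mem_Gamma0 hγj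
      rw [sieve_E2hat_smul hγj, ← hu, sq_eq_one_of_unit (by omega), mul_one]
    | zero => simp
    | add g h _ _ hg hh => simp only [Pi.add_apply, hg, hh, mul_add]
    | smul a g _ hg => simp only [Pi.smul_apply, hg, smul_eq_mul]; ring
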